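/- Let $\mathcal X,\mathcal Y$ be sets, let $\mathbf X_N\subseteq\mathcal X$ be a set of $N=m+u$ points, $m,u\ge 1$, let $\phi\colon\mathcal X\to\mathcal Y$ be a target function, $\ell\colon\mathcal Y^2\to[0,1]$ a loss function and $\mathcal H$ a class of functions $h\colon\mathcal X\to\mathcal Y$. Write $\ell_h(X)=\ell(h(X),\phi(X))$. For a finite nonempty $A\subseteq\mathcal X$ and $f\colon\mathcal X\to\mathbb R$ put $E_Af=\frac1{|A|}\sum_{X\in A}f(X)$, and write $E=E_{\mathbf X_N}$. A training set $\mathbf X_m\subseteq\mathbf X_N$ of $m$ points is drawn uniformly without replacement from $\mathbf X_N$, and $\mathbf X_u=\mathbf X_N\setminus\mathbf X_m$ is the test set. Put $L_N(h)=E\ell_h$, $\hat L_m(h)=E_{\mathbf X_m}\ell_h$, $L_u(h)=E_{\mathbf X_u}\ell_h$, and $\mathcal E_u(h)=L_u(h)-\inf_{g\in\mathcal H}L_u(g)$. Let $\hat h_m\in\mathcal H$ (depending on the sample) minimize $\hat L_m$ over $\mathcal H$. Assume that some $h^*_N\in\mathcal H$ satisfies $L_N(h^*_N)=\inf_{h\in\mathcal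 H}L_N(h)$ and that, with $\mathcal F^*=\{\ell_h-\ell_{h^*_N}:h\in\mathcal H\}$, there is a constant $B>0$ such that $Ef^2\le B\cdot Ef$ for all $f\in\mathcal F^*$. A function $\psi\colon[0,\infty)\to[0,\infty)$ is called sub-root if it is nondecreasing and $r\mapsto\psi(r)/\sqrt r$ is nonincreasing on $(0,\infty)$. For $k\in\{m,u\}$ let $\psi_k$ be a sub-root function such that, for all $r\ge0$, $$B\,\mathbb E\Bigl[\sup_{f\in\mathcal F^*,\,Ef^2\le r}\bigl(Ef-E_{S_k}f\bigr)\Bigr]\le\psi_k(r),$$ where $S_k$ is a set of $k$ points drawn uniformly without replacement from $\mathbf X_N$, and let $r^*_k>0$ be a fixed point of $\psi_k$, i.e. $\psi_k(r^*_k)=r^*_k$. Then for every $t>0$, with probability greater than $1-2e^{-t}$, $$\mathcal E_u(\hat h_m)\le\frac Nu\left(51\frac{r^*_m}{B}+17Bt\frac N{m^2}\right)+\frac Nm\left(51\frac{r^*_u}{B}+17Bt\frac N{u^2}\right).$$ -/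

import Mathlib

namespace Transductive

noncomputable section

variable {𝒳 𝒴 : Type*}

/-- The average of `f` over a finite set `A`: this is `E f` for `A` the full set of points and the
empirical mean `Ê f` for `A` a sample. -/
def avg (A : Finset 𝒳) (f : 𝒳 → ℝ) : ℝ :=
  (∑ x ∈ A, f x) / (A.card : ℝ)

/-- The expectation of `g S`, where `S` is a sample of `k` points drawn uniformly without
replacement from `XN`, that is, a uniformly distributed `k`-element subset of `XN`. -/
def sampleExp (XN : Finset 𝒳) (k : ℕ) (g : Finset 𝒳 → ℝ) : ℝ :=
  (∑ S ∈ XN.powersetCard k, g S) / ((XN.powersetCard k).card : ℝ)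

open Classical in
/-- The probability of the event `p S`, where `S` is a sample of `k` points drawn uniformly without
replacement from `XN`. -/
def sampleProb (XN : Finset 𝒳) (k : ℕ) (p : Finset 𝒳 → Prop) : ℝ :=
  (((XN.powersetCard k).filter p).card : ℝ) / ((XN.powersetCard k).card : ℝ)

/-- The loss `ℓ_h(x) = ℓ(h(x), φ(x))` of the predictor `h`, where `φ` is the target function. -/
def lossOf (l : 𝒴 → 𝒴 → ℝ) (φ : 𝒳 → 𝒴) (h : 𝒳 → 𝒴) : 𝒳 → ℝ :=
  fun x => l (h x) (φ x)

/-- The error of `h` on the finite set `A`: the training, test or overall error of `h` for `A` the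
training set, the test set or the full set of points. -/
def err (l : 𝒴 → 𝒴 → ℝ) (φ : 𝒳 → 𝒴) (A : Finset 𝒳) (h : 𝒳 → 𝒴) : ℝ :=
  avg A (lossOf l φ h)

/-- The excess risk of `h` over the class `H` on the finite set `A`. -/
def excessRisk (l : 𝒴 → 𝒴 → ℝ) (φ : 𝒳 → 𝒴) (H : Set (𝒳 → 𝒴)) (A : Finset 𝒳)
    (h : 𝒳 → 𝒴) : ℝ :=
  err l φ A h - ⨅ g : H, err l φ A g

/-- The excess loss class `{ℓ_h - ℓ_{hstar} : h ∈ H}`. -/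
def excessLossClass (l : 𝒴 → 𝒴 → ℝ) (φ : 𝒳 → 𝒴) (H : Set (𝒳 → 𝒴)) (hstar : 𝒳 → 𝒴) :
    Set (𝒳 → ℝ) :=
  {f | ∃ h ∈ H, f = fun x => lossOf l φ h x - lossOf l φ hstar x}

/-- The localized complexity `𝔼[sup_{f ∈ F, E f² ≤ r} (E f - Ê_k f)]` of the class `F`, for a
sample of `k` points drawn uniformly without replacement from `XN`. -/
def localComplexity (F : Set (𝒳 → ℝ)) (XN : Finset 𝒳) (k : ℕ) (r : ℝ) : ℝ :=
  sampleExp XN k fun S =>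
    sSup ((fun f => avg XN f - avg S f) '' {f ∈ F | avg XN (fun x => f x ^ 2) ≤ r})

/-- Sub-root functions `ψ : [0,∞) → [0,∞)`; only the values on `[0,∞)` matter. -/
structure IsSubRoot (ψ : ℝ → ℝ) : Prop where
  nonneg : ∀ r, 0 ≤ r → 0 ≤ ψ r
  mono : MonotoneOn ψ (Set.Ici 0)
  anti : AntitoneOn (fun r => ψ r / √r) (Set.Ioi 0)

/-- `hhat` is an empirical risk minimization rule over `H` for samples of `m` points: it maps every
possible training set to a minimizer in `H` of the training error. -/
def IsERM (l : 𝒴 → 𝒴 → ℝ) (φ : 𝒳 → 𝒴) (H : Set (𝒳 → 𝒴)) (XN : Finset 𝒳) (m : ℕ)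
    (hhat : Finset 𝒳 → 𝒳 → 𝒴) : Prop :=
  ∀ S ∈ XN.powersetCard m, hhat S ∈ H ∧ IsMinOn (err l φ S) H (hhat S)

end

end Transductive

namespace Transductive

/-! The training set and the test set are both uniform samples without replacement, so one deviation
bound for such samples serves twice. For a sample of `k` points, with probability greater than `1 -
e^{-t}`, every excess loss `f` with `Ê f ≤ 0` satisfies `E f - Ê f ≤ 51 r*/B + 17 B t N / k²`
(`sampleProb_exists_dev_gt_le`). On the training set this applies to the empirical minimizer. On the
test set it applies to every `g ∈ H` that does at least as well there as `h*_N`. Since the overall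
mean is a weighted mean of the training and test means, the two bounds control the test excess risk,
and a union bound gives the factor 2.

The deviation bound has two ingredients. The first is sub-Gaussian concentration of a supremum of
deviations, in which only the second moments of the class enter. It follows by the entropy method: a
modified logarithmic Sobolev inequality for exchanges of one point (`card_mul_sliceEnt_le`, by
induction on the ground set), the Herbst argument, and a bound on one-sided exchange variations
(`supDev_swap_sq_sum_le`).

The second is localization. Shrinking each `f` until `E f² ≤ r` makes the concentration uniform over
the class; peeling and the sub-root property bound the expected supremum by `5 ψ(r) / B`. The
Bernstein condition `E f² ≤ B E f` then shows that, for a suitable `r`, no `f` with a large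
deviation was shrunk. -/

variable {𝒳 : Type*}

/-! ### Convexity properties of `(a - b) (log a - log b)`. -/

/-- The integrand `(a - b) (log a - log b)` of the modified logarithmic Sobolev inequality. -/
noncomputable def logDiff (a b : ℝ) : ℝ :=
  (a - b) * (Real.log a - Real.log b)

/-- The unnormalized entropy of `f` on the `k`-element subsets of `X`. -/
noncomputable def sliceEnt (X : Finset 𝒳) (k : ℕ) (f : Finset 𝒳 → ℝ) : ℝ :=
  ∑ S ∈ X.powersetCard k, f S * Real.log (f S) -
    (∑ S ∈ X.powersetCard k, f S) *
      Real.log ((∑ S ∈ X.powersetCard k, f S) / ((X.powersetCard k).card : ℝ))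

/-- The sum of `F S S'` over all `k`-element subsets `S` of `X` and all `S'` obtained from `S` by
exchanging an element of `S` for one of `X \ S`. -/
def swapSum [DecidableEq 𝒳] (X : Finset 𝒳) (k : ℕ) (F : Finset 𝒳 → Finset 𝒳 → ℝ) : ℝ :=
  ∑ S ∈ X.powersetCard k, ∑ a ∈ S, ∑ b ∈ X \ S, F S (insert b (S.erase a))

theorem logDiff_nonneg {a b : ℝ} (ha : 0 < a) (hb : 0 < b) : 0 ≤ logDiff a b := by
  unfold logDiff
  rcases le_total a b with h | h
  · have := Real.log_le_log ha h
    nlinarith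
  · have := Real.log_le_log hb h
    nlinarith

theorem logDiff_comm (a b : ℝ) : logDiff a b = logDiff b a := by
  unfold logDiff; ring

theorem logDiff_mul {c a b : ℝ} (hc : 0 < c) (ha : 0 < a) (hb : 0 < b) :
    logDiff (c * a) (c * b) = c * logDiff a b := by
  unfold logDiff
  rw [Real.log_mul hc.ne' ha.ne', Real.log_mul hc.ne' hb.ne']
  ring

/-- Termwise use of `log x ≤ x - 1` at `x = (b i / a i) * (A / C)`, where `A` and `C` are the two
totals; the linear corrections sum to zero. -/
theorem log_sum_inequality {ι : Type*} (s : Finset ι) (a b : ι → ℝ)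
    (ha : ∀ i ∈ s, 0 < a i) (hb : ∀ i ∈ s, 0 < b i) :
    (∑ i ∈ s, a i) * (Real.log (∑ i ∈ s, a i) - Real.log (∑ i ∈ s, b i)) ≤
      ∑ i ∈ s, a i * (Real.log (a i) - Real.log (b i)) := by
  rcases s.eq_empty_or_nonempty with rfl | hs
  · simp
  have hA : 0 < ∑ i ∈ s, a i := Finset.sum_pos ha hs
  have hB : 0 < ∑ i ∈ s, b i := Finset.sum_pos hb hs
  set A := ∑ i ∈ s, a i
  set C := ∑ i ∈ s, b i
  have key : ∀ i ∈ s, a i * (Real.log A - Real.log C) + (a i - b i * (A / C)) ≤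
      a i * (Real.log (a i) - Real.log (b i)) := by
    intro i hi
    have h1 := ha i hi
    have h2 := hb i hi
    have h3 : Real.log (b i * A / (a i * C)) ≤ b i * A / (a i * C) - 1 :=
      Real.log_le_sub_one_of_pos (by positivity)
    rw [Real.log_div (by positivity) (by positivity), Real.log_mul h2.ne' hA.ne',
      Real.log_mul h1.ne' hB.ne'] at h3
    have h4 := mul_le_mul_of_nonneg_left h3 h1.le
    have h5 : a i * (b i * A / (a i * C) - 1) = b i * (A / C) - a i := by
      field_simp
    rw [h5] at h4
    linarith
  calc A * (Real.log A - Real.log C)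
      = ∑ i ∈ s, (a i * (Real.log A - Real.log C) + (a i - b i * (A / C))) := by
        rw [Finset.sum_add_distrib, Finset.sum_sub_distrib, ← Finset.sum_mul, ← Finset.sum_mul]
        field_simp
        ring
    _ ≤ _ := Finset.sum_le_sum key

/-- `logDiff` is the sum of two relative-entropy terms, so the log-sum inequality is used in both
directions. -/
theorem logDiff_sum_le {ι : Type*} (s : Finset ι) (a b : ι → ℝ)
    (ha : ∀ i ∈ s, 0 < a i) (hb : ∀ i ∈ s, 0 < b i) :
    logDiff (∑ i ∈ s, a i) (∑ i ∈ s, b i) ≤ ∑ i ∈ s, logDiff (a i) (b i) := by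
  have h1 := log_sum_inequality s a b ha hb
  have h2 := log_sum_inequality s b a hb ha
  have h3 : ∑ i ∈ s, logDiff (a i) (b i) =
      ∑ i ∈ s, a i * (Real.log (a i) - Real.log (b i)) +
        ∑ i ∈ s, b i * (Real.log (b i) - Real.log (a i)) := by
    rw [← Finset.sum_add_distrib]
    exact Finset.sum_congr rfl fun i _ => by unfold logDiff; ring
  rw [h3]
  unfold logDiff
  linarith

/-- The entropy of a function with two values `a` and `b`, of weights `p` and `q`. -/
theorem two_point_entropy_le {p q a b : ℝ} (hp : 0 < p) (hq : 0 < q) (ha : 0 < a) (hb : 0 < b) :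
    p * a * Real.log a + q * b * Real.log b -
        (p * a + q * b) * Real.log ((p * a + q * b) / (p + q)) ≤
      p * q / (p + q) * logDiff a b := by
  have h := strictConcaveOn_log_Ioi.concaveOn.2 (Set.mem_Ioi.2 ha) (Set.mem_Ioi.2 hb)
    (show 0 ≤ p / (p + q) by positivity) (show 0 ≤ q / (p + q) by positivity) (by field_simp)
  simp only [smul_eq_mul] at h
  have e : p / (p + q) * a + q / (p + q) * b = (p * a + q * b) / (p + q) := by ring
  rw [e] at h
  have h2 := mul_le_mul_of_nonneg_left h (by positivity : 0 ≤ p * a + q * b)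
  have e2 : p * a * Real.log a + q * b * Real.log b - (p * a + q * b) *
      (p / (p + q) * Real.log a + q / (p + q) * Real.log b) = p * q / (p + q) * logDiff a b := by
    unfold logDiff
    field_simp
    ring
  linarith

/-! ### Exchanges of one point and the modified logarithmic Sobolev inequality on slices. -/

section

variable [DecidableEq 𝒳]

theorem sum_powersetCard_succ_erase {X : Finset 𝒳} {i : 𝒳} (hi : i ∈ X) (k : ℕ)
    (F : Finset 𝒳 → ℝ) :
    ∑ S ∈ X.powersetCard (k + 1), F S =
      ∑ S ∈ (X.erase i).powersetCard (k + 1), F S +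
        ∑ S ∈ (X.erase i).powersetCard k, F (insert i S) := by
  conv_lhs => rw [← Finset.insert_erase hi]
  rw [Finset.powersetCard_succ_insert (Finset.notMem_erase i X), Finset.sum_union, Finset.sum_image]
  · intro S hS T hT h
    have hS' : i ∉ S := fun h => Finset.notMem_erase i X ((Finset.mem_powersetCard.1 hS).1 h)
    have hT' : i ∉ T := fun h => Finset.notMem_erase i X ((Finset.mem_powersetCard.1 hT).1 h)
    rw [← Finset.erase_insert hS', h, Finset.erase_insert hT']
  · rw [Finset.disjoint_left]
    intro S hS hS'
    obtain ⟨T, -, rfl⟩ := Finset.mem_image.1 hS'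
    exact Finset.notMem_erase i X ((Finset.mem_powersetCard.1 hS).1 (Finset.mem_insert_self i T))

theorem sum_powersetCard_sum_insert (Y : Finset 𝒳) (k : ℕ) (F : Finset 𝒳 → 𝒳 → ℝ) :
    ∑ S ∈ Y.powersetCard k, ∑ j ∈ Y \ S, F (insert j S) j =
      ∑ S ∈ Y.powersetCard (k + 1), ∑ j ∈ S, F S j := by
  rw [Finset.sum_sigma', Finset.sum_sigma']
  refine Finset.sum_nbij' (fun p => ⟨insert p.2 p.1, p.2⟩) (fun p => ⟨p.1.erase p.2, p.2⟩)
    ?_ ?_ ?_ ?_ ?_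
  · rintro ⟨S, j⟩ h
    simp only [Finset.mem_sigma, Finset.mem_powersetCard, Finset.mem_sdiff] at h ⊢
    refine ⟨⟨Finset.insert_subset h.2.1 h.1.1, ?_⟩, Finset.mem_insert_self _ _⟩
    rw [Finset.card_insert_of_notMem h.2.2, h.1.2]
  · rintro ⟨S, j⟩ h
    simp only [Finset.mem_sigma, Finset.mem_powersetCard, Finset.mem_sdiff] at h ⊢
    refine ⟨⟨(Finset.erase_subset _ _).trans h.1.1, ?_⟩, h.1.1 h.2, Finset.notMem_erase _ _⟩
    rw [Finset.card_erase_of_mem h.2, h.1.2]; rfl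
  · rintro ⟨S, j⟩ h
    simp only [Finset.mem_sigma, Finset.mem_sdiff] at h
    simp [Finset.erase_insert h.2.2]
  · rintro ⟨S, j⟩ h
    simp only [Finset.mem_sigma] at h
    simp [Finset.insert_erase h.2]
  · rintro ⟨S, j⟩ _
    rfl

/-- Indexing an exchange by the common part of the two samples and its two extra points makes the
symmetry `swapSum_comm` visible. -/
theorem swapSum_eq (X : Finset 𝒳) (k : ℕ) (F : Finset 𝒳 → Finset 𝒳 → ℝ) :
    swapSum X (k + 1) F = ∑ S ∈ X.powersetCard k, ∑ a ∈ X \ S, ∑ b ∈ X \ S,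
      if a = b then 0 else F (insert a S) (insert b S) := by
  have h := sum_powersetCard_sum_insert X k
    (fun S a => ∑ b ∈ X \ S, F S (insert b (S.erase a)))
  unfold swapSum
  rw [← h]
  refine Finset.sum_congr rfl fun S _ => Finset.sum_congr rfl fun a ha => ?_
  rw [Finset.erase_insert (Finset.mem_sdiff.1 ha).2]
  have e : X \ insert a S = (X \ S).filter (fun b => ¬ a = b) := by
    ext b
    simp only [Finset.mem_sdiff, Finset.mem_insert, Finset.mem_filter]
    tauto
  rw [e, Finset.sum_filter]
  exact Finset.sum_congr rfl fun b _ => by split_ifs <;> simp_all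

theorem swapSum_comm (X : Finset 𝒳) (k : ℕ) (F : Finset 𝒳 → Finset 𝒳 → ℝ) :
    swapSum X k (fun S S' => F S' S) = swapSum X k F := by
  cases k with
  | zero => simp [swapSum]
  | succ k =>
    rw [swapSum_eq, swapSum_eq]
    refine Finset.sum_congr rfl fun S _ => ?_
    rw [Finset.sum_comm]
    exact Finset.sum_congr rfl fun b _ => Finset.sum_congr rfl fun a _ => by
      simp only [eq_comm]

/-- A pair `(a, b)` survives the removal of `i` for all `i` except `a` and `b`, hence the factor
`|X| - 2`. -/
theorem sum_sum_erase_sum_erase {X S : Finset 𝒳} (hS : S ⊆ X) (F : 𝒳 → 𝒳 → ℝ) :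
    ∑ i ∈ X, ∑ a ∈ S.erase i, ∑ b ∈ (X \ S).erase i, F a b =
      ((X.card : ℝ) - 2) * ∑ a ∈ S, ∑ b ∈ X \ S, F a b := by
  have h1 : ∀ i ∈ X, ∑ a ∈ S.erase i, ∑ b ∈ (X \ S).erase i, F a b =
      ∑ a ∈ S, ∑ b ∈ X \ S, F a b -
        (∑ a ∈ S, if a = i then ∑ b ∈ X \ S, F a b else 0) -
        (∑ b ∈ X \ S, if b = i then ∑ a ∈ S, F a b else 0) := by
    intro i hi
    by_cases his : i ∈ S
    · have h2 : i ∉ X \ S := fun h => (Finset.mem_sdiff.1 h).2 his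
      rw [Finset.erase_eq_of_notMem h2, Finset.sum_ite_eq', Finset.sum_ite_eq', if_pos his,
        if_neg h2, sub_zero, ← Finset.add_sum_erase S _ his]
      ring
    · have h2 : i ∈ X \ S := Finset.mem_sdiff.2 ⟨hi, his⟩
      rw [Finset.erase_eq_of_notMem his, Finset.sum_ite_eq', Finset.sum_ite_eq', if_neg his,
        if_pos h2, sub_zero, ← Finset.sum_sub_distrib]
      refine Finset.sum_congr rfl fun a _ => ?_
      rw [← Finset.add_sum_erase _ _ h2]
      ring
  rw [Finset.sum_congr rfl h1, Finset.sum_sub_distrib, Finset.sum_sub_distrib,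
    Finset.sum_comm (s := X) (t := S) (f := fun i a => if a = i then ∑ b ∈ X \ S, F a b else 0),
    Finset.sum_comm (s := X) (t := X \ S)]
  have h3 : ∀ a ∈ S, (∑ i ∈ X, if a = i then ∑ b ∈ X \ S, F a b else 0) = ∑ b ∈ X \ S, F a b :=
    fun a ha => by rw [Finset.sum_ite_eq, if_pos (hS ha)]
  have h4 : ∀ b ∈ X \ S, (∑ i ∈ X, if b = i then ∑ a ∈ S, F a b else 0) = ∑ a ∈ S, F a b :=
    fun b hb => by rw [Finset.sum_ite_eq, if_pos (Finset.sdiff_subset hb)]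
  rw [Finset.sum_congr rfl h3, Finset.sum_congr rfl h4, Finset.sum_comm (s := X \ S),
    Finset.sum_const, nsmul_eq_mul]
  ring

/-- Conditioning on whether `i` is in the sample keeps exactly the exchanges that do not involve
`i`; this is the averaging used in the induction. -/
theorem sum_swapSum_erase (X : Finset 𝒳) (k : ℕ) (F : Finset 𝒳 → Finset 𝒳 → ℝ) :
    ∑ i ∈ X, (swapSum (X.erase i) (k + 1) F +
      swapSum (X.erase i) k (fun S S' => F (insert i S) (insert i S'))) =
      ((X.card : ℝ) - 2) * swapSum X (k + 1) F := by
  have h1 : ∀ i ∈ X, swapSum (X.erase i) (k + 1) F +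
      swapSum (X.erase i) k (fun S S' => F (insert i S) (insert i S')) =
      ∑ S ∈ X.powersetCard (k + 1), ∑ a ∈ S.erase i, ∑ b ∈ (X \ S).erase i,
        F S (insert b (S.erase a)) := by
    intro i hi
    rw [sum_powersetCard_succ_erase hi]
    unfold swapSum
    congr 1
    · refine Finset.sum_congr rfl fun S hS => ?_
      have hiS : i ∉ S := fun h => Finset.notMem_erase i X ((Finset.mem_powersetCard.1 hS).1 h)
      rw [Finset.erase_eq_of_notMem hiS, Finset.erase_sdiff_comm]
    · refine Finset.sum_congr rfl fun S hS => ?_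
      have hiS : i ∉ S := fun h => Finset.notMem_erase i X ((Finset.mem_powersetCard.1 hS).1 h)
      rw [Finset.erase_insert hiS]
      refine Finset.sum_congr rfl fun a ha => ?_
      have hai : i ≠ a := fun h => hiS (h ▸ ha)
      have e : X.erase i \ S = (X \ insert i S).erase i := by
        ext b
        simp only [Finset.mem_sdiff, Finset.mem_erase, Finset.mem_insert]
        tauto
      rw [e]
      refine Finset.sum_congr rfl fun b _ => ?_
      rw [Finset.erase_insert_of_ne hai, Finset.insert_comm]
  rw [Finset.sum_congr rfl h1, Finset.sum_comm]
  unfold swapSum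
  rw [Finset.mul_sum]
  exact Finset.sum_congr rfl fun S hS => sum_sum_erase_sum_erase (Finset.mem_powersetCard.1 hS).1 _

/-- Each exchange occurs once, with `i` the point that leaves the sample. -/
theorem sum_swapSum_insert (X : Finset 𝒳) (k : ℕ) (F : Finset 𝒳 → Finset 𝒳 → ℝ) :
    ∑ i ∈ X, ∑ S ∈ (X.erase i).powersetCard k, ∑ b ∈ X.erase i \ S,
      F (insert i S) (insert b S) = swapSum X (k + 1) F := by
  unfold swapSum
  have h1 : ∀ i ∈ X, ∑ S ∈ (X.erase i).powersetCard k, ∑ b ∈ X.erase i \ S,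
      F (insert i S) (insert b S) = ∑ S ∈ X.powersetCard (k + 1),
        if i ∈ S then ∑ b ∈ X \ S, F S (insert b (S.erase i)) else 0 := by
    intro i hi
    rw [sum_powersetCard_succ_erase hi]
    rw [Finset.sum_eq_zero (s := (X.erase i).powersetCard (k + 1)), zero_add]
    · refine Finset.sum_congr rfl fun S hS => ?_
      have hiS : i ∉ S := fun h => Finset.notMem_erase i X ((Finset.mem_powersetCard.1 hS).1 h)
      rw [if_pos (Finset.mem_insert_self i S), Finset.erase_insert hiS]
      have e : X.erase i \ S = X \ insert i S := by
        ext b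
        simp only [Finset.mem_sdiff, Finset.mem_erase, Finset.mem_insert]
        tauto
      rw [e]
    · intro S hS
      rw [if_neg fun h => Finset.notMem_erase i X ((Finset.mem_powersetCard.1 hS).1 h)]
  rw [Finset.sum_congr rfl h1, Finset.sum_comm]
  refine Finset.sum_congr rfl fun S hS => ?_
  rw [← Finset.sum_filter, Finset.filter_mem_eq_inter,
    Finset.inter_eq_right.2 (Finset.mem_powersetCard.1 hS).1]

/-- Decomposition of the entropy according to whether `i` belongs to the sample. -/
theorem sliceEnt_le_erase {X : Finset 𝒳} {i : 𝒳} (hi : i ∈ X) {k : ℕ} (hk : k + 1 < X.card)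
    {f : Finset 𝒳 → ℝ} (hf : ∀ S, 0 < f S) :
    sliceEnt X (k + 1) f ≤ sliceEnt (X.erase i) (k + 1) f +
      sliceEnt (X.erase i) k (fun S => f (insert i S)) +
      (1 / X.card) * ∑ S ∈ (X.erase i).powersetCard k, ∑ b ∈ X.erase i \ S,
        logDiff (f (insert i S)) (f (insert b S)) := by
  obtain ⟨n, hn⟩ : ∃ n, X.card = n + 1 := ⟨X.card - 1, by omega⟩
  set Y := X.erase i with hY
  have hYc : Y.card = n := by rw [hY, Finset.card_erase_of_mem hi, hn]; rfl
  have hkn : k + 1 ≤ n := by omega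
  set s1 := ∑ S ∈ Y.powersetCard k, f (insert i S) with hs1
  set s0 := ∑ S ∈ Y.powersetCard (k + 1), f S with hs0
  have hT1 : 0 < ((n.choose k : ℕ) : ℝ) := by exact_mod_cast Nat.choose_pos (by omega)
  have hT0 : 0 < ((n.choose (k + 1) : ℕ) : ℝ) := by exact_mod_cast Nat.choose_pos hkn
  have hne1 : (Y.powersetCard k).Nonempty := Finset.powersetCard_nonempty.2 (by omega)
  have hne0 : (Y.powersetCard (k + 1)).Nonempty := Finset.powersetCard_nonempty.2 (by omega)
  have hs1p : 0 < s1 := Finset.sum_pos (fun S _ => hf _) hne1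
  have hs0p : 0 < s0 := Finset.sum_pos (fun S _ => hf _) hne0
  set T1 := ((n.choose k : ℕ) : ℝ) with hT1d
  set T0 := ((n.choose (k + 1) : ℕ) : ℝ) with hT0d
  have hnk : (0 : ℝ) < (n : ℝ) - k := by
    have : ((k + 1 : ℕ) : ℝ) ≤ n := by exact_mod_cast hkn
    push_cast at this; linarith
  -- Both sides count the pairs `(S, b)` with `|S| = k` and `b ∈ Y \ S`. These pairs couple the
  -- samples containing `i` with those avoiding it, through `insert i S` and `insert b S`.
  have hM : ((n : ℝ) - k) * T1 = (k + 1) * T0 := by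
    have h := Nat.choose_succ_right_eq n k
    have h' : (T0 * ((k : ℝ) + 1)) = T1 * ((n - k : ℕ) : ℝ) := by
      rw [hT0d, hT1d]; exact_mod_cast h
    rw [Nat.cast_sub (by omega)] at h'
    linarith
  have hTT : (((n + 1).choose (k + 1) : ℕ) : ℝ) = T1 + T0 := by
    rw [Nat.choose_succ_succ]; push_cast; rfl
  have hpt := two_point_entropy_le hT1 hT0 (div_pos hs1p hT1) (div_pos hs0p hT0)
  -- Both totals are written as sums over the coupled pairs, and subadditivity of `logDiff` passes
  -- to single exchanges.
  have hconv : logDiff (((n : ℝ) - k) * s1) ((k + 1) * s0) ≤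
      ∑ S ∈ Y.powersetCard k, ∑ b ∈ Y \ S, logDiff (f (insert i S)) (f (insert b S)) := by
    have e1 : ((n : ℝ) - k) * s1 = ∑ p ∈ (Y.powersetCard k).sigma (fun S => Y \ S),
        f (insert i p.1) := by
      rw [Finset.sum_sigma, hs1, Finset.mul_sum]
      refine Finset.sum_congr rfl fun S hS => ?_
      obtain ⟨hSY, hSc⟩ := Finset.mem_powersetCard.1 hS
      dsimp only
      rw [Finset.sum_const, nsmul_eq_mul, Finset.card_sdiff_of_subset hSY, hYc, hSc,
        Nat.cast_sub (by omega)]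
    have e0 : ((k : ℝ) + 1) * s0 = ∑ p ∈ (Y.powersetCard k).sigma (fun S => Y \ S),
        f (insert p.2 p.1) := by
      rw [Finset.sum_sigma]
      have h := sum_powersetCard_sum_insert Y k (fun S _ => f S)
      simp only at h ⊢
      rw [h, hs0, Finset.mul_sum]
      refine Finset.sum_congr rfl fun S hS => ?_
      rw [Finset.sum_const, nsmul_eq_mul, (Finset.mem_powersetCard.1 hS).2]
      push_cast; rfl
    rw [e1, e0, Finset.sum_sigma']
    exact logDiff_sum_le _ _ _ (fun _ _ => hf _) (fun _ _ => hf _)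
  have hsc : logDiff (((n : ℝ) - k) * s1) ((k + 1) * s0) =
      ((n - k) * T1) * logDiff (s1 / T1) (s0 / T0) := by
    rw [← logDiff_mul (by positivity) (div_pos hs1p hT1) (div_pos hs0p hT0)]
    congr 1
    · field_simp
    · rw [hM]; field_simp
  have hcoef : T1 * T0 / (T1 + T0) = (1 / ((n : ℝ) + 1)) * ((n - k) * T1) := by
    have : ((n : ℝ) - k) * (T1 + T0) = (n + 1) * T0 := by linear_combination hM
    field_simp
    linarith
  rw [hsc] at hconv
  rw [hcoef, mul_assoc (1 / ((n : ℝ) + 1))] at hpt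
  have hpt2 := hpt.trans (mul_le_mul_of_nonneg_left hconv (by positivity))
  unfold sliceEnt
  rw [sum_powersetCard_succ_erase hi, sum_powersetCard_succ_erase hi, Finset.card_powersetCard,
    Finset.card_powersetCard, Finset.card_powersetCard, hn, hTT, ← hY, hYc, ← hs0, ← hs1]
  have c1 : T1 * (s1 / T1) = s1 := by field_simp
  have c0 : T0 * (s0 / T0) = s0 := by field_simp
  rw [c1, c0, add_comm s1 s0] at hpt2
  push_cast
  linarith

/-- The modified logarithmic Sobolev inequality for the uniform distribution on the `k`-element
subsets of a finite set. -/
theorem card_mul_sliceEnt_le (X : Finset 𝒳) (k : ℕ) (f : Finset 𝒳 → ℝ) (hf : ∀ S, 0 < f S) :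
    X.card * sliceEnt X k f ≤ swapSum X k (fun S S' => logDiff (f S) (f S')) := by
  induction hn : X.card generalizing X k f with
  | zero =>
    rw [Nat.cast_zero, zero_mul]
    exact Finset.sum_nonneg fun S _ => Finset.sum_nonneg fun a _ => Finset.sum_nonneg fun b _ =>
      logDiff_nonneg (hf _) (hf _)
  | succ n ih =>
    have hD : 0 ≤ swapSum X k (fun S S' => logDiff (f S) (f S')) :=
      Finset.sum_nonneg fun S _ => Finset.sum_nonneg fun a _ => Finset.sum_nonneg fun b _ =>
        logDiff_nonneg (hf _) (hf _)
    rcases k with _ | k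
    · simpa [sliceEnt] using hD
    rcases lt_trichotomy (k + 1) X.card with hk | hk | hk
    -- The decomposition is summed over all `i`, rather than applied to a fixed one, so that every
    -- exchange is treated alike.
    · have hsum := Finset.sum_le_sum fun i hi => sliceEnt_le_erase (i := i) (X := X) hi hk hf
      have hc : ∀ i ∈ X, (X.erase i).card = n := fun i hi => by
        rw [Finset.card_erase_of_mem hi, hn]; rfl
      have hn1 : (1 : ℝ) ≤ n := by
        have : 1 ≤ n := by omega
        exact_mod_cast this
      have hsum2 : ∀ i ∈ X, n * (sliceEnt (X.erase i) (k + 1) f +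
          sliceEnt (X.erase i) k (fun S => f (insert i S))) ≤
          swapSum (X.erase i) (k + 1) (fun S S' => logDiff (f S) (f S')) +
          swapSum (X.erase i) k (fun S S' => logDiff (f (insert i S)) (f (insert i S'))) := by
        intro i hi
        have a1 := ih (X.erase i) (k + 1) f hf (hc i hi)
        have a2 := ih (X.erase i) k (fun S => f (insert i S)) (fun _ => hf _) (hc i hi)
        rw [mul_add]
        exact add_le_add a1 a2
      have hsum3 := Finset.sum_le_sum hsum2
      rw [sum_swapSum_erase X k (fun S S' => logDiff (f S) (f S')), ← Finset.mul_sum] at hsum3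
      rw [Finset.sum_const, nsmul_eq_mul, Finset.sum_add_distrib, ← Finset.mul_sum,
        sum_swapSum_insert X k (fun S S' => logDiff (f S) (f S'))] at hsum
      rw [hn] at hsum hsum3
      push_cast at hsum hsum3 ⊢
      set D := swapSum X (k + 1) (fun S S' => logDiff (f S) (f S'))
      set P := ∑ i ∈ X, (sliceEnt (X.erase i) (k + 1) f +
        sliceEnt (X.erase i) k (fun S => f (insert i S)))
      have hP : P ≤ ((n : ℝ) - 1) / n * D := by
        rw [div_mul_eq_mul_div, le_div_iff₀ (by linarith)]
        linarith
      -- The induction closes because the left side is `1 - 1/n + 1/(n+1)`.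
      have hfin : ((n : ℝ) - 1) / n + 1 / ((n : ℝ) + 1) ≤ 1 := by
        rw [div_add_div _ _ (by positivity) (by positivity), div_le_one (by positivity)]
        nlinarith
      nlinarith
    · rw [sliceEnt, hk, Finset.powersetCard_self, ← hk]
      simpa using hD
    · rw [sliceEnt, Finset.powersetCard_eq_empty.2 hk]
      simpa using hD

end

/-! ### From entropy to sub-Gaussian tails. -/

theorem herbst_argument {L L' : ℝ → ℝ} {C : ℝ} (h0 : L 0 = 0)
    (hd : ∀ x, HasDerivAt L (L' x) x) (h : ∀ x, 0 < x → x * L' x - L x ≤ C * x ^ 2)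
    {x : ℝ} (hx : 0 < x) : L x ≤ x * L' 0 + C * x ^ 2 := by
  -- The hypothesis says precisely that `L y / y - C y` has nonpositive derivative for `y > 0`; its
  -- limit at `0` is `L' 0`.
  have hder : ∀ y, 0 < y →
      HasDerivAt (fun y => L y / y - C * y) ((L' y * y - L y * 1) / y ^ 2 - C * 1) y := fun y hy =>
    ((hd y).div (hasDerivAt_id y) hy.ne').sub ((hasDerivAt_id y).const_mul C)
  have hanti : AntitoneOn (fun y => L y / y - C * y) (Set.Ioi 0) := by
    apply antitoneOn_of_deriv_nonpos (convex_Ioi 0)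
    · exact fun y hy => (hder y hy).continuousAt.continuousWithinAt
    · rw [interior_Ioi]
      exact fun y hy => (hder y hy).differentiableAt.differentiableWithinAt
    · rw [interior_Ioi]
      intro y hy
      have hy' : 0 < y := hy
      rw [(hder y hy).deriv]
      have h1 := h y hy
      have h2 : (L' y * y - L y * 1) / y ^ 2 ≤ C := by
        rw [div_le_iff₀ (by positivity)]
        linarith
      linarith
  have hlim : Filter.Tendsto (fun y => L y / y - C * y) (nhdsWithin 0 (Set.Ioi 0))
      (nhds (L' 0)) := by
    have h1 : Filter.Tendsto (fun y => L y / y) (nhdsWithin 0 (Set.Ioi 0)) (nhds (L' 0)) := by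
      have h2 := (hasDerivAt_iff_tendsto_slope.1 (hd 0)).mono_left
        (nhdsWithin_mono 0 (fun y (hy : 0 < y) => hy.ne') :
          nhdsWithin (0 : ℝ) (Set.Ioi 0) ≤ nhdsWithin 0 {0}ᶜ)
      refine h2.congr fun y => ?_
      rw [slope_def_field, h0, sub_zero, sub_zero]
    have h3 : Filter.Tendsto (fun y : ℝ => C * y) (nhdsWithin 0 (Set.Ioi 0)) (nhds (C * 0)) :=
      (Filter.tendsto_id.const_mul C).mono_left nhdsWithin_le_nhds
    simpa using h1.sub h3
  have hle : L x / x - C * x ≤ L' 0 := by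
    refine ge_of_tendsto hlim ?_
    filter_upwards [Ioo_mem_nhdsGT hx] with y hy
    exact hanti hy.1 hx hy.2.le
  have h4 : L x / x ≤ L' 0 + C * x := by linarith
  rw [div_le_iff₀ hx] at h4
  nlinarith

/-- At most one term on the right is nonzero. Positive parts are kept so that, after symmetrization,
only decreases of the function under an exchange count. -/
theorem logDiff_exp_le (x y : ℝ) : logDiff (Real.exp x) (Real.exp y) ≤
    max 0 (x - y) ^ 2 * Real.exp x + max 0 (y - x) ^ 2 * Real.exp y := by
  have key : ∀ x y : ℝ, y ≤ x → logDiff (Real.exp x) (Real.exp y) ≤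
      (x - y) ^ 2 * Real.exp x := by
    intro x y h
    unfold logDiff
    rw [Real.log_exp, Real.log_exp]
    have h1 := Real.add_one_le_exp (y - x)
    have h2 : Real.exp y = Real.exp x * Real.exp (y - x) := by
      rw [← Real.exp_add]; ring_nf
    have h3 : Real.exp x - Real.exp y ≤ (x - y) * Real.exp x := by
      rw [h2]
      nlinarith [Real.exp_pos x]
    nlinarith
  rcases le_total y x with h | h
  · rw [max_eq_right (sub_nonneg.2 h), max_eq_left (sub_nonpos.2 h)]
    simpa using key x y h
  · rw [max_eq_left (sub_nonpos.2 h), max_eq_right (sub_nonneg.2 h), logDiff_comm]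
    simpa using key y x h

theorem card_mul_sliceEnt_exp_le [DecidableEq 𝒳] {X : Finset 𝒳} {k : ℕ} {g : Finset 𝒳 → ℝ} {v : ℝ}
    (hv : ∀ S ∈ X.powersetCard k,
      ∑ a ∈ S, ∑ b ∈ X \ S, max 0 (g S - g (insert b (S.erase a))) ^ 2 ≤ v)
    {c : ℝ} (hc : 0 ≤ c) :
    X.card * sliceEnt X k (fun S => Real.exp (c * g S)) ≤
      2 * c ^ 2 * v * ∑ S ∈ X.powersetCard k, Real.exp (c * g S) := by
  set Q : Finset 𝒳 → Finset 𝒳 → ℝ :=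
    fun S S' => max 0 (c * g S - c * g S') ^ 2 * Real.exp (c * g S) with hQ
  have h1 := card_mul_sliceEnt_le X k (fun S => Real.exp (c * g S)) (fun _ => Real.exp_pos _)
  have h2 : swapSum X k (fun S S' => logDiff (Real.exp (c * g S)) (Real.exp (c * g S'))) ≤
      swapSum X k Q + swapSum X k (fun S S' => Q S' S) := by
    unfold swapSum
    simp only [← Finset.sum_add_distrib]
    exact Finset.sum_le_sum fun S _ => Finset.sum_le_sum fun a _ => Finset.sum_le_sum fun b _ =>
      logDiff_exp_le _ _
  -- Reversing the exchanges identifies the two one-sided sums, whence the factor 2.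
  rw [swapSum_comm X k Q] at h2
  have h3 : swapSum X k Q ≤ c ^ 2 * v * ∑ S ∈ X.powersetCard k, Real.exp (c * g S) := by
    unfold swapSum
    rw [Finset.mul_sum]
    refine Finset.sum_le_sum fun S hS => ?_
    simp only [hQ, ← Finset.sum_mul]
    refine mul_le_mul_of_nonneg_right ?_ (Real.exp_pos _).le
    have h4 : ∀ a b, max 0 (c * g S - c * g (insert b (S.erase a))) ^ 2 =
        c ^ 2 * max 0 (g S - g (insert b (S.erase a))) ^ 2 := by
      intro a b
      rw [← mul_pow, mul_max_of_nonneg _ _ hc, mul_zero, mul_sub]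
    simp only [h4, ← Finset.mul_sum]
    exact mul_le_mul_of_nonneg_left (hv S hS) (sq_nonneg c)
  linarith

theorem sum_exp_le [DecidableEq 𝒳] {X : Finset 𝒳} (hX : 0 < X.card) {k : ℕ} (hk : k ≤ X.card)
    {g : Finset 𝒳 → ℝ} {v : ℝ}
    (hv : ∀ S ∈ X.powersetCard k,
      ∑ a ∈ S, ∑ b ∈ X \ S, max 0 (g S - g (insert b (S.erase a))) ^ 2 ≤ v)
    {c : ℝ} (hc : 0 < c) :
    ∑ S ∈ X.powersetCard k, Real.exp (c * g S) ≤ (X.powersetCard k).card *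
      Real.exp (c * sampleExp X k g + 2 * v / X.card * c ^ 2) := by
  have hne : (X.powersetCard k).Nonempty := Finset.powersetCard_nonempty.2 hk
  have hT : (0 : ℝ) < (X.powersetCard k).card := by exact_mod_cast hne.card_pos
  have hN : (0 : ℝ) < X.card := by exact_mod_cast hX
  set T : ℝ := ((X.powersetCard k).card : ℝ) with hTdef
  set M : ℝ → ℝ := fun c => ∑ S ∈ X.powersetCard k, Real.exp (c * g S) with hM
  set M' : ℝ → ℝ := fun c => ∑ S ∈ X.powersetCard k, Real.exp (c * g S) * g S with hM'
  have hMpos : ∀ c, 0 < M c := fun c => Finset.sum_pos (fun _ _ => Real.exp_pos _) hne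
  have hMd : ∀ c, HasDerivAt M (M' c) c := by
    intro c
    apply HasDerivAt.fun_sum
    intro S _
    exact (hasDerivAt_mul_const (g S)).exp
  have hL : ∀ c, HasDerivAt (fun c => Real.log (M c / T)) (M' c / M c) c := by
    intro c
    have := ((hMd c).div_const T).log (div_pos (hMpos c) hT).ne'
    convert this using 1
    field_simp
  have hM0 : M 0 = T := by simp [hM, hTdef]
  have hM'0 : M' 0 / M 0 = sampleExp X k g := by
    rw [hM0, sampleExp]; simp [hM', hTdef]
  have key := herbst_argument (L := fun c => Real.log (M c / T)) (L' := fun c => M' c / M c)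
    (C := 2 * v / X.card) (by simp only [hM0, div_self hT.ne', Real.log_one]) hL (by
      intro c hc
      have h := card_mul_sliceEnt_exp_le hv hc.le
      unfold sliceEnt at h
      simp only [Real.log_exp] at h
      have e : ∑ S ∈ X.powersetCard k, Real.exp (c * g S) * (c * g S) = c * M' c := by
        rw [hM', Finset.mul_sum]
        exact Finset.sum_congr rfl fun _ _ => by ring
      rw [e] at h
      change X.card * (c * M' c - M c * Real.log (M c / T)) ≤ 2 * c ^ 2 * v * M c at h
      have h5 : c * (M' c / M c) - Real.log (M c / T) =
          (X.card * (c * M' c - M c * Real.log (M c / T))) / (X.card * M c) := by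
        have := (hMpos c).ne'
        field_simp
      have h6 : 2 * v / X.card * c ^ 2 = (2 * c ^ 2 * v * M c) / (X.card * M c) := by
        have := (hMpos c).ne'
        field_simp
      rw [h5, h6]
      exact div_le_div_of_nonneg_right h (mul_pos hN (hMpos c)).le) hc
  simp only [hM'0] at key
  rw [Real.log_le_iff_le_exp (div_pos (hMpos c) hT), div_le_iff₀ hT] at key
  rw [mul_comm T]
  exact key

theorem sampleProb_mono {X : Finset 𝒳} {k : ℕ} {p q : Finset 𝒳 → Prop}
    (h : ∀ S ∈ X.powersetCard k, p S → q S) : sampleProb X k p ≤ sampleProb X k q := by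
  classical
  unfold sampleProb
  refine div_le_div_of_nonneg_right ?_ (Nat.cast_nonneg _)
  refine Nat.cast_le.2 (Finset.card_le_card fun S hS => ?_)
  rw [Finset.mem_filter] at hS ⊢
  exact ⟨hS.1, h S hS.1 hS.2⟩

/-- Sub-Gaussian concentration for sampling without replacement. -/
theorem sampleProb_lt_le_exp_neg [DecidableEq 𝒳] {X : Finset 𝒳} (hX : 0 < X.card) {k : ℕ}
    (hk : k ≤ X.card) {g : Finset 𝒳 → ℝ} {v : ℝ} (hv0 : 0 < v)
    (hv : ∀ S ∈ X.powersetCard k,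
      ∑ a ∈ S, ∑ b ∈ X \ S, max 0 (g S - g (insert b (S.erase a))) ^ 2 ≤ v)
    {t : ℝ} (ht : 0 < t) :
    sampleProb X k (fun S => sampleExp X k g + √(8 * v * t / X.card) < g S) ≤ Real.exp (-t) := by
  classical
  have hne : (X.powersetCard k).Nonempty := Finset.powersetCard_nonempty.2 hk
  have hT : (0 : ℝ) < (X.powersetCard k).card := by exact_mod_cast hne.card_pos
  have hN : (0 : ℝ) < X.card := by exact_mod_cast hX
  set C : ℝ := 2 * v / X.card with hC
  have hCpos : 0 < C := by positivity
  -- The minimizer of `C c² - c δ` for the deviation `δ = 2 √(C t) = √(8 v t / N)`.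
  set c : ℝ := √(t / C) with hcdef
  have hc : 0 < c := Real.sqrt_pos.2 (by positivity)
  have hc2 : C * c ^ 2 = t := by
    rw [hcdef, Real.sq_sqrt (by positivity)]; field_simp
  have he : √(8 * v * t / X.card) = 2 * C * c := by
    rw [Real.sqrt_eq_iff_mul_self_eq (by positivity) (by positivity)]
    calc 8 * v * t / X.card = 4 * C * (C * c ^ 2) := by rw [hc2, hC]; ring
      _ = 2 * C * c * (2 * C * c) := by ring
  have h := sum_exp_le hX hk hv hc
  rw [he]
  set μ := sampleExp X k g
  set A := (X.powersetCard k).filter (fun S => μ + 2 * C * c < g S) with hA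
  have h1 : (A.card : ℝ) * Real.exp (c * (μ + 2 * C * c)) ≤
      ∑ S ∈ X.powersetCard k, Real.exp (c * g S) := by
    rw [← nsmul_eq_mul, ← Finset.sum_const]
    refine (Finset.sum_le_sum fun S hS => ?_).trans
      (Finset.sum_le_sum_of_subset_of_nonneg (Finset.filter_subset _ _)
        fun _ _ _ => (Real.exp_pos _).le)
    exact Real.exp_le_exp.2 (mul_le_mul_of_nonneg_left (Finset.mem_filter.1 hS).2.le hc.le)
  have h2 : sampleProb X k (fun S => μ + 2 * C * c < g S) =
      (A.card : ℝ) / (X.powersetCard k).card := by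
    unfold sampleProb
    congr!
  rw [h2, div_le_iff₀ hT]
  have h3 := h1.trans h
  have h4 : c * (μ + 2 * C * c) = (c * μ + C * c ^ 2) + t := by linear_combination hc2
  rw [h4, Real.exp_add] at h3
  rw [Real.exp_neg, ← div_eq_inv_mul, le_div_iff₀ (Real.exp_pos _)]
  have h5 := Real.exp_pos (c * μ + C * c ^ 2)
  refine le_of_mul_le_mul_right ?_ h5
  linarith

/-! ### Concentration of the supremum of deviations. -/

/-- The supremum of `E f - Ê f` over `f ∈ F` for the sample `S`. -/
noncomputable def supDev (F : Set (𝒳 → ℝ)) (X S : Finset 𝒳) : ℝ :=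
  sSup ((fun f => avg X f - avg S f) '' F)

theorem avg_mono {A : Finset 𝒳} {f g : 𝒳 → ℝ} (h : ∀ x, f x ≤ g x) : avg A f ≤ avg A g :=
  div_le_div_of_nonneg_right (Finset.sum_le_sum fun x _ => h x) (Nat.cast_nonneg _)

theorem avg_nonneg {A : Finset 𝒳} {f : 𝒳 → ℝ} (h : ∀ x, 0 ≤ f x) : 0 ≤ avg A f :=
  div_nonneg (Finset.sum_nonneg fun x _ => h x) (Nat.cast_nonneg _)

theorem avg_const_le_one (A : Finset 𝒳) : avg A (fun _ => (1 : ℝ)) ≤ 1 := by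
  simp only [avg, Finset.sum_const, nsmul_eq_mul, mul_one]
  exact div_self_le_one _

theorem avg_const_mul (A : Finset 𝒳) (c : ℝ) (f : 𝒳 → ℝ) :
    avg A (fun x => c * f x) = c * avg A f := by
  simp only [avg, ← Finset.mul_sum, mul_div_assoc]

theorem avg_sub (A : Finset 𝒳) (f g : 𝒳 → ℝ) :
    avg A (fun x => f x - g x) = avg A f - avg A g := by
  simp only [avg, Finset.sum_sub_distrib, sub_div]

theorem abs_avg_le_one {A : Finset 𝒳} {f : 𝒳 → ℝ} (h : ∀ x, |f x| ≤ 1) : |avg A f| ≤ 1 := by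
  rw [abs_le]
  constructor
  · have h1 : avg A (fun x => -1 * f x) ≤ 1 :=
      (avg_mono fun x => by linarith [(abs_le.1 (h x)).1]).trans (avg_const_le_one A)
    rw [avg_const_mul] at h1
    linarith
  · exact (avg_mono fun x => (abs_le.1 (h x)).2).trans (avg_const_le_one A)

theorem bddAbove_dev {F : Set (𝒳 → ℝ)} (hF : ∀ f ∈ F, ∀ x, |f x| ≤ 1) (X S : Finset 𝒳) :
    BddAbove ((fun f => avg X f - avg S f) '' F) := by
  refine ⟨2, ?_⟩
  rintro _ ⟨f, hf, rfl⟩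
  have h1 := abs_le.1 (abs_avg_le_one (A := X) (hF f hf))
  have h2 := abs_le.1 (abs_avg_le_one (A := S) (hF f hf))
  change avg X f - avg S f ≤ 2
  linarith

theorem le_supDev {F : Set (𝒳 → ℝ)} (hF : ∀ f ∈ F, ∀ x, |f x| ≤ 1) (X S : Finset 𝒳)
    {f : 𝒳 → ℝ} (hf : f ∈ F) : avg X f - avg S f ≤ supDev F X S :=
  le_csSup (bddAbove_dev hF X S) ⟨f, hf, rfl⟩

/-- After expanding, the cross term `-2 (∑ f a) (∑ f b)` is at most the sum of the two squares, and
Cauchy–Schwarz bounds each. -/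
theorem sum_sum_sub_sq_le [DecidableEq 𝒳] {X S : Finset 𝒳} (hS : S ⊆ X) (f : 𝒳 → ℝ) :
    ∑ a ∈ S, ∑ b ∈ X \ S, (f b - f a) ^ 2 ≤ (X.card : ℝ) * ∑ x ∈ X, f x ^ 2 := by
  have e : ∑ a ∈ S, ∑ b ∈ X \ S, (f b - f a) ^ 2 =
      (S.card : ℝ) * ∑ b ∈ X \ S, f b ^ 2 + ((X \ S).card : ℝ) * ∑ a ∈ S, f a ^ 2 -
        2 * ((∑ a ∈ S, f a) * ∑ b ∈ X \ S, f b) := by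
    have h1 : ∀ a ∈ S, ∑ b ∈ X \ S, (f b - f a) ^ 2 =
        ∑ b ∈ X \ S, f b ^ 2 + ((X \ S).card : ℝ) * f a ^ 2 - 2 * (f a * ∑ b ∈ X \ S, f b) := by
      intro a _
      rw [← nsmul_eq_mul, ← Finset.sum_const, Finset.mul_sum, Finset.mul_sum,
        ← Finset.sum_add_distrib, ← Finset.sum_sub_distrib]
      exact Finset.sum_congr rfl fun b _ => by ring
    rw [Finset.sum_congr rfl h1, Finset.sum_sub_distrib, Finset.sum_add_distrib, Finset.sum_const,
      nsmul_eq_mul, ← Finset.mul_sum, ← Finset.mul_sum, ← Finset.sum_mul]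
  have h2 := sq_sum_le_card_mul_sum_sq (s := S) (f := f)
  have h3 := sq_sum_le_card_mul_sum_sq (s := X \ S) (f := f)
  have h4 : (X.card : ℝ) = S.card + (X \ S).card := by
    rw [← Finset.card_sdiff_add_card_eq_card hS]; push_cast; ring
  rw [e, h4, ← Finset.sum_sdiff hS]
  nlinarith [sq_nonneg ((∑ a ∈ S, f a) + ∑ b ∈ X \ S, f b)]

theorem avg_swap_sub_avg [DecidableEq 𝒳] {S : Finset 𝒳} {a b : 𝒳} (ha : a ∈ S) (hb : b ∉ S)
    (f : 𝒳 → ℝ) :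
    avg (insert b (S.erase a)) f - avg S f = (f b - f a) / S.card := by
  have hb' : b ∉ S.erase a := fun h => hb (Finset.mem_of_mem_erase h)
  have hc : (insert b (S.erase a)).card = S.card := by
    rw [Finset.card_insert_of_notMem hb', Finset.card_erase_of_mem ha]
    have := Finset.card_pos.2 ⟨a, ha⟩
    omega
  unfold avg
  rw [hc, Finset.sum_insert hb', ← Finset.add_sum_erase S f ha]
  ring

/-- One near-maximizer `g` for `S` serves for all exchanges, because only decreases of the supremum
count. As the maximum need not be attained, `g` is `δ`-optimal and `δ → 0` at the end. -/
theorem supDev_swap_sq_sum_le [DecidableEq 𝒳] {G : Set (𝒳 → ℝ)} (hG0 : G.Nonempty)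
    (hG : ∀ g ∈ G, ∀ x, |g x| ≤ 1) {X S : Finset 𝒳} {r : ℝ}
    (hr : ∀ g ∈ G, avg X (fun x => g x ^ 2) ≤ r) (hS : S ⊆ X) :
    ∑ a ∈ S, ∑ b ∈ X \ S, max 0 (supDev G X S - supDev G X (insert b (S.erase a))) ^ 2 ≤
      (X.card : ℝ) ^ 2 * r / (S.card : ℝ) ^ 2 := by
  have key : ∀ δ : ℝ, 0 < δ →
      ∑ a ∈ S, ∑ b ∈ X \ S, max 0 (supDev G X S - supDev G X (insert b (S.erase a))) ^ 2 ≤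
      (1 + δ) * ((X.card : ℝ) ^ 2 * r / (S.card : ℝ) ^ 2) +
        S.card * ((X \ S).card * (δ + δ ^ 2)) := by
    intro δ hδ
    obtain ⟨_, ⟨g, hg, rfl⟩, hgδ⟩ := exists_lt_of_lt_csSup (hG0.image _)
      (sub_lt_self (supDev G X S) hδ)
    dsimp only at hgδ
    have h1 : ∀ a ∈ S, ∀ b ∈ X \ S,
        max 0 (supDev G X S - supDev G X (insert b (S.erase a))) ^ 2 ≤
        (1 + δ) / (S.card : ℝ) ^ 2 * (g b - g a) ^ 2 + (δ + δ ^ 2) := by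
      intro a ha b hb
      have h2 := le_supDev hG X (insert b (S.erase a)) hg
      have h3 := avg_swap_sub_avg ha (Finset.mem_sdiff.1 hb).2 g
      set d := (g b - g a) / (S.card : ℝ) with hd
      have h4 : supDev G X S - supDev G X (insert b (S.erase a)) ≤ d + δ := by linarith
      have h5 : (1 + δ) / (S.card : ℝ) ^ 2 * (g b - g a) ^ 2 = (1 + δ) * d ^ 2 := by
        rw [hd, div_pow]; ring
      rw [h5]
      rcases le_total (supDev G X S - supDev G X (insert b (S.erase a))) 0 with h | h
      · rw [max_eq_left h, zero_pow two_ne_zero]; positivity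
      · rw [max_eq_right h]
        have h6 := pow_le_pow_left₀ h h4 2
        -- `(d + δ)² ≤ (1 + δ) d² + δ + δ²` is equivalent to `δ (d - 1)² ≥ 0`.
        nlinarith [mul_nonneg hδ.le (sq_nonneg (d - 1))]
    refine (Finset.sum_le_sum fun a ha => Finset.sum_le_sum (h1 a ha)).trans ?_
    simp only [Finset.sum_add_distrib, Finset.sum_const, nsmul_eq_mul, ← Finset.mul_sum]
    have h7 := sum_sum_sub_sq_le hS g
    have h8 : (X.card : ℝ) * ∑ x ∈ X, g x ^ 2 ≤ (X.card : ℝ) ^ 2 * r := by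
      rcases X.card.eq_zero_or_pos with h0 | h0
      · simp [h0]
      · have h9 : (0 : ℝ) < X.card := by exact_mod_cast h0
        have h10 := hr g hg
        unfold avg at h10
        rw [div_le_iff₀ h9] at h10
        nlinarith
    have h11 := calc (1 + δ) / (S.card : ℝ) ^ 2 * ∑ a ∈ S, ∑ b ∈ X \ S, (g b - g a) ^ 2
        ≤ (1 + δ) / (S.card : ℝ) ^ 2 * ((X.card : ℝ) ^ 2 * r) :=
          mul_le_mul_of_nonneg_left (h7.trans h8) (by positivity)
      _ = (1 + δ) * ((X.card : ℝ) ^ 2 * r / (S.card : ℝ) ^ 2) := by ring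
    linarith
  have hlim : Filter.Tendsto (fun δ : ℝ =>
      (1 + δ) * ((X.card : ℝ) ^ 2 * r / (S.card : ℝ) ^ 2) +
        S.card * ((X \ S).card * (δ + δ ^ 2))) (nhdsWithin 0 (Set.Ioi 0))
      (nhds ((X.card : ℝ) ^ 2 * r / (S.card : ℝ) ^ 2)) := by
    have hc : Continuous (fun δ : ℝ =>
      (1 + δ) * ((X.card : ℝ) ^ 2 * r / (S.card : ℝ) ^ 2) +
        S.card * ((X \ S).card * (δ + δ ^ 2))) := by fun_prop
    have := (hc.tendsto 0).mono_left (nhdsWithin_le_nhds (s := Set.Ioi 0))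
    simpa using this
  refine ge_of_tendsto hlim ?_
  filter_upwards [self_mem_nhdsWithin] with δ hδ
  exact key δ hδ

theorem supDev_concentration [DecidableEq 𝒳] {G : Set (𝒳 → ℝ)} (hG0 : G.Nonempty)
    (hG : ∀ g ∈ G, ∀ x, |g x| ≤ 1) {X : Finset 𝒳} {r : ℝ} (hr0 : 0 < r)
    (hr : ∀ g ∈ G, avg X (fun x => g x ^ 2) ≤ r) {k : ℕ} (hk0 : 0 < k) (hk : k ≤ X.card)
    {t : ℝ} (ht : 0 < t) :
    sampleProb X k (fun S => sampleExp X k (supDev G X) + √r * (√(8 * X.card * t) / k) <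
      supDev G X S) ≤ Real.exp (-t) := by
  have hX : 0 < X.card := by omega
  have hN : (0 : ℝ) < X.card := by exact_mod_cast hX
  have hk' : (0 : ℝ) < k := by exact_mod_cast hk0
  have h := sampleProb_lt_le_exp_neg hX hk (g := supDev G X)
    (v := (X.card : ℝ) ^ 2 * r / (k : ℝ) ^ 2) (by positivity) (fun S hS => by
      obtain ⟨h1, h2⟩ := Finset.mem_powersetCard.1 hS
      rw [← h2]
      exact supDev_swap_sq_sum_le hG0 hG hr h1) ht
  have e : √(8 * ((X.card : ℝ) ^ 2 * r / (k : ℝ) ^ 2) * t / X.card) =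
      √r * (√(8 * X.card * t) / k) := by
    rw [← mul_div_assoc (√r), ← Real.sqrt_mul hr0.le]
    nth_rewrite 2 [← Real.sqrt_sq hk'.le]
    rw [← Real.sqrt_div (by positivity)]
    congr 1
    field_simp
  rw [e] at h
  exact h

/-! ### Rescaled classes, peeling and sub-root functions. -/

theorem sampleExp_mono {X : Finset 𝒳} {k : ℕ} {g g' : Finset 𝒳 → ℝ}
    (h : ∀ S ∈ X.powersetCard k, g S ≤ g' S) : sampleExp X k g ≤ sampleExp X k g' :=
  div_le_div_of_nonneg_right (Finset.sum_le_sum h) (Nat.cast_nonneg _)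

theorem sampleExp_add_sum {ι : Type*} (s : Finset ι) (X : Finset 𝒳) (k : ℕ)
    (g : Finset 𝒳 → ℝ) (c : ι → ℝ) (q : ι → Finset 𝒳 → ℝ) :
    sampleExp X k (fun S => g S + ∑ i ∈ s, c i * q i S) =
      sampleExp X k g + ∑ i ∈ s, c i * sampleExp X k (q i) := by
  unfold sampleExp
  rw [Finset.sum_add_distrib, add_div, Finset.sum_comm, Finset.sum_div s]
  simp only [← Finset.mul_sum, mul_div_assoc]

theorem IsSubRoot.le_sqrt_mul {ψ : ℝ → ℝ} (hψ : IsSubRoot ψ) {s r : ℝ} (hs : 0 < s) (hsr : s ≤ r) :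
    ψ r ≤ √(r / s) * ψ s := by
  have hr : 0 < r := hs.trans_le hsr
  have h := hψ.anti (Set.mem_Ioi.2 hs) (Set.mem_Ioi.2 hr) hsr
  simp only at h
  rw [div_le_iff₀ (Real.sqrt_pos.2 hr)] at h
  rw [Real.sqrt_div hr.le]
  calc ψ r ≤ ψ s / √s * √r := h
    _ = _ := by ring

/-- The functions of `F` whose second moment is at most `r`. -/
def localClass (F : Set (𝒳 → ℝ)) (X : Finset 𝒳) (r : ℝ) : Set (𝒳 → ℝ) :=
  {f ∈ F | avg X (fun x => f x ^ 2) ≤ r}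

/-- The functions of `F` rescaled so as to have second moment at most `r`. -/
def scaledClass (F : Set (𝒳 → ℝ)) (X : Finset 𝒳) (r : ℝ) : Set (𝒳 → ℝ) :=
  (fun f x => r / max r (avg X (fun x => f x ^ 2)) * f x) '' F

theorem scaledClass_abs_le_one {F : Set (𝒳 → ℝ)} (hF : ∀ f ∈ F, ∀ x, |f x| ≤ 1) (X : Finset 𝒳)
    {r : ℝ} (hr : 0 < r) : ∀ g ∈ scaledClass F X r, ∀ x, |g x| ≤ 1 := by
  rintro _ ⟨f, hf, rfl⟩ x
  have hw : 0 < max r (avg X (fun x => f x ^ 2)) := lt_max_of_lt_left hr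
  have h1 : r / max r (avg X (fun x => f x ^ 2)) ≤ 1 := (div_le_one hw).2 (le_max_left _ _)
  have h0 : 0 ≤ r / max r (avg X (fun x => f x ^ 2)) := by positivity
  dsimp only
  rw [abs_mul, abs_of_nonneg h0]
  exact mul_le_one₀ h1 (abs_nonneg _) (hF f hf x)

theorem scaledClass_avg_sq_le {F : Set (𝒳 → ℝ)} (X : Finset 𝒳) {r : ℝ} (hr : 0 < r) :
    ∀ g ∈ scaledClass F X r, avg X (fun x => g x ^ 2) ≤ r := by
  rintro _ ⟨f, hf, rfl⟩
  simp only [mul_pow, avg_const_mul]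
  set T := avg X (fun x => f x ^ 2)
  have hw : 0 < max r T := lt_max_of_lt_left hr
  rw [div_pow, div_mul_eq_mul_div, div_le_iff₀ (by positivity)]
  have h1 : r * T ≤ max r T * max r T :=
    mul_le_mul (le_max_left r T) (le_max_right r T) (avg_nonneg fun x => sq_nonneg _) hw.le
  nlinarith

/-- Peeling: if `r 4^i < E f² ≤ r 4^(i+1)`, the scaling factor is at most `4^{-i}`. Finitely many
shells suffice since `E f² ≤ 1`. The zero function makes every local supremum nonnegative, so the
unused shells can be added. -/
theorem scaledClass_supDev_le {F : Set (𝒳 → ℝ)} (hF : ∀ f ∈ F, ∀ x, |f x| ≤ 1)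
    (h0 : (fun _ => 0) ∈ F) (X S : Finset 𝒳) {r : ℝ} (hr : 0 < r) {n : ℕ} (hn : 1 ≤ r * 4 ^ n) :
    supDev (scaledClass F X r) X S ≤ supDev (localClass F X r) X S +
      ∑ i ∈ Finset.range n, (1 / 4 : ℝ) ^ i * supDev (localClass F X (r * 4 ^ (i + 1))) X S := by
  have hbd : ∀ ρ, ∀ f ∈ localClass F X ρ, ∀ x, |f x| ≤ 1 := fun ρ f hf => hF f hf.1
  have hnonneg : ∀ ρ, 0 < ρ → 0 ≤ supDev (localClass F X ρ) X S := by
    intro ρ hρ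
    have hm : (fun _ => 0) ∈ localClass F X ρ := ⟨h0, by simpa [avg] using hρ.le⟩
    simpa [avg] using le_supDev (hbd ρ) X S hm
  have hterm : ∀ i ∈ Finset.range n,
      0 ≤ (1 / 4 : ℝ) ^ i * supDev (localClass F X (r * 4 ^ (i + 1))) X S := fun i _ =>
    mul_nonneg (by positivity) (hnonneg _ (by positivity))
  apply csSup_le
  · exact Set.Nonempty.image _ (Set.Nonempty.image _ ⟨_, h0⟩)
  rintro _ ⟨_, ⟨f, hf, rfl⟩, rfl⟩
  simp only [avg_const_mul, ← mul_sub]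
  set T := avg X (fun x => f x ^ 2) with hT
  by_cases hTr : T ≤ r
  · rw [max_eq_left hTr, div_self hr.ne', one_mul]
    have := le_supDev (hbd r) X S (f := f) ⟨hf, hTr⟩
    have := Finset.sum_nonneg hterm
    linarith
  · push Not at hTr
    have hT1 : T ≤ 1 :=
      (avg_mono fun x => (sq_le_one_iff_abs_le_one _).2 (hF f hf x)).trans (avg_const_le_one X)
    have hex : ∃ j, T ≤ r * 4 ^ j := ⟨n, hT1.trans hn⟩
    classical
    obtain ⟨i, hi⟩ : ∃ i, Nat.find hex = i + 1 :=
      Nat.exists_eq_succ_of_ne_zero fun h => by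
        have := Nat.find_spec hex
        rw [h, pow_zero, mul_one] at this
        linarith
    have hup : T ≤ r * 4 ^ (i + 1) := hi ▸ Nat.find_spec hex
    have hlow : r * 4 ^ i < T := not_le.1 (Nat.find_min hex (by omega))
    have hin : i ∈ Finset.range n := by
      have := Nat.find_min' hex (hT1.trans hn)
      exact Finset.mem_range.2 (by omega)
    rw [max_eq_right hTr.le]
    have hTpos : 0 < T := hr.trans hTr
    have h1 : r / T ≤ (1 / 4 : ℝ) ^ i := by
      rw [div_le_iff₀ hTpos, one_div, inv_pow, ← div_eq_inv_mul, le_div_iff₀ (by positivity)]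
      exact hlow.le
    have h2 := le_supDev (hbd (r * 4 ^ (i + 1))) X S (f := f) ⟨hf, hup⟩
    have h3 := Finset.single_le_sum hterm hin
    calc r / T * (avg X f - avg S f)
        ≤ r / T * supDev (localClass F X (r * 4 ^ (i + 1))) X S :=
          mul_le_mul_of_nonneg_left h2 (by positivity)
      _ ≤ (1 / 4 : ℝ) ^ i * supDev (localClass F X (r * 4 ^ (i + 1))) X S :=
          mul_le_mul_of_nonneg_right h1 (hnonneg _ (by positivity))
      _ ≤ _ := by linarith [hnonneg r hr]

/-- The sub-root property gives `ψ(r 4^(i+1)) ≤ 2^(i+1) ψ(r)`, so shell `i` contributes at most `2 ·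
2^{-i} ψ(r)`. The shells total at most `4 ψ(r)`, and the unscaled part adds one more. -/
theorem scaledClass_sampleExp_supDev_le {F : Set (𝒳 → ℝ)} (hF : ∀ f ∈ F, ∀ x, |f x| ≤ 1)
    (h0 : (fun _ => 0) ∈ F) (X : Finset 𝒳) (k : ℕ) {B : ℝ} {ψ : ℝ → ℝ}
    (hψ : IsSubRoot ψ) (hb : ∀ r, 0 ≤ r → B * localComplexity F X k r ≤ ψ r) (hB : 0 < B)
    {r : ℝ} (hr : 0 < r) :
    B * sampleExp X k (supDev (scaledClass F X r) X) ≤ 5 * ψ r := by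
  obtain ⟨n, hn⟩ := pow_unbounded_of_one_lt (1 / r) (by norm_num : (1 : ℝ) < 4)
  have hn' : 1 ≤ r * 4 ^ n := by
    rw [div_lt_iff₀ hr] at hn
    linarith
  have h1 := sampleExp_mono (k := k) fun S (_ : S ∈ X.powersetCard k) =>
    scaledClass_supDev_le hF h0 X S hr hn'
  rw [sampleExp_add_sum] at h1
  have h2 : ∀ i ∈ Finset.range n, B * ((1 / 4 : ℝ) ^ i *
      sampleExp X k (supDev (localClass F X (r * 4 ^ (i + 1))) X)) ≤ 2 * ψ r * (1 / 2) ^ i := by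
    intro i _
    have h3 := hb (r * 4 ^ (i + 1)) (by positivity)
    have h4 : r ≤ r * 4 ^ (i + 1) := le_mul_of_one_le_right hr.le (one_le_pow₀ (by norm_num))
    have h5 := hψ.le_sqrt_mul hr h4
    have h6 : √(r * 4 ^ (i + 1) / r) = 2 ^ (i + 1) := by
      rw [mul_div_cancel_left₀ _ hr.ne', Real.sqrt_eq_iff_mul_self_eq (by positivity) (by positivity),
        ← mul_pow]
      norm_num
    rw [h6] at h5
    have h7 : (1 / 4 : ℝ) ^ i * (2 ^ (i + 1) * ψ r) = 2 * ψ r * (1 / 2) ^ i := by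
      rw [show (1 / 4 : ℝ) = 1 / 2 * (1 / 2) by norm_num, mul_pow, pow_succ]
      have : (1 / 2 : ℝ) ^ i * 2 ^ i = 1 := by rw [← mul_pow]; norm_num
      linear_combination 2 * ψ r * (1 / 2) ^ i * this
    rw [← h7, mul_left_comm]
    exact mul_le_mul_of_nonneg_left (h3.trans h5) (by positivity)
  have h8 : ∑ i ∈ Finset.range n, (1 / 2 : ℝ) ^ i ≤ 2 := by
    simpa using sum_geometric_two_le n
  have h9 := Finset.sum_le_sum h2
  rw [← Finset.mul_sum, ← Finset.mul_sum] at h9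
  have h10 := mul_le_mul_of_nonneg_left h1 hB.le
  rw [mul_add] at h10
  have h11 : B * sampleExp X k (supDev (localClass F X r) X) ≤ ψ r := hb r hr.le
  have h12 := hψ.nonneg r hr.le
  nlinarith

/-! ### The deviation bound at the fixed point. -/

/-- The deviation `E f - Ê f` of the functions of `F` whose empirical mean is nonpositive. -/
theorem sampleProb_exists_dev_gt_le [DecidableEq 𝒳] {F : Set (𝒳 → ℝ)}
    (hF : ∀ f ∈ F, ∀ x, |f x| ≤ 1) (h0 : (fun _ => 0) ∈ F) {X : Finset 𝒳} {k : ℕ} (hk0 : 0 < k)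
    (hk : k ≤ X.card) {B : ℝ} (hB : 0 < B)
    (hBern : ∀ f ∈ F, avg X (fun x => f x ^ 2) ≤ B * avg X f) {ψ : ℝ → ℝ}
    (hψ : IsSubRoot ψ) (hb : ∀ r, 0 ≤ r → B * localComplexity F X k r ≤ ψ r)
    {ρ : ℝ} (hρ : 0 < ρ) (hfix : ψ ρ = ρ) {t : ℝ} (ht : 0 < t) :
    sampleProb X k (fun S => ∃ f ∈ F, avg S f ≤ 0 ∧
      51 * ρ / B + 17 * B * t * (X.card / (k : ℝ) ^ 2) < avg X f - avg S f) < Real.exp (-t) := by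
  have hX : 0 < X.card := by omega
  have hN : (0 : ℝ) < X.card := by exact_mod_cast hX
  have hk' : (0 : ℝ) < k := by exact_mod_cast hk0
  -- Slightly more than `t`: this makes the final inequality strict and uses up the rounding in the
  -- constant, `51/50 · 2 · 8 · 25/24 = 17`.
  set t' : ℝ := 25 / 24 * t with ht'
  have ht'0 : 0 < t' := by positivity
  set q : ℝ := √(8 * X.card * t') / k with hq
  have hq2 : q ^ 2 = 8 * X.card * t' / (k : ℝ) ^ 2 := by
    rw [hq, div_pow, Real.sq_sqrt (by positivity)]
  have hq0 : 0 ≤ q := by positivity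
  set A : ℝ := 5 * √ρ / B + q with hA
  have hρs : 0 < √ρ := Real.sqrt_pos.2 hρ
  have hApos : 0 < A := by positivity
  -- The localization radius is `s²`, and the supremum will be at most `s A`. Taking `s` strictly
  -- above `B A` excludes shrunk functions; `51/50 · 2 · 25 = 51` gives the other constant.
  set s : ℝ := 51 / 50 * B * A with hs
  have hspos : 0 < s := by positivity
  have hsρ : √ρ ≤ s := by
    have : s = 51 / 10 * √ρ + 51 / 50 * B * q := by
      rw [hs, hA]; field_simp; ring
    have := mul_nonneg hB.le hq0
    linarith
  have hr : 0 < s ^ 2 := by positivity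
  have hρr : ρ ≤ s ^ 2 := by
    rw [← Real.sq_sqrt hρ.le]
    exact pow_le_pow_left₀ hρs.le hsρ 2
  have hconc := supDev_concentration (G := scaledClass F X (s ^ 2)) (Set.Nonempty.image _ ⟨_, h0⟩)
    (scaledClass_abs_le_one hF X hr) hr (scaledClass_avg_sq_le X hr) hk0 hk ht'0
  rw [Real.sqrt_sq hspos.le, ← hq] at hconc
  have hexp : sampleExp X k (supDev (scaledClass F X (s ^ 2)) X) ≤ s * (5 * √ρ / B) := by
    have h1 := scaledClass_sampleExp_supDev_le hF h0 X k hψ hb hB hr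
    have h2 := hψ.le_sqrt_mul hρ hρr
    rw [Real.sqrt_div (sq_nonneg s), Real.sqrt_sq hspos.le, hfix] at h2
    have h3 : s / √ρ * ρ = s * √ρ := by
      nth_rewrite 2 [← Real.sq_sqrt hρ.le]
      field_simp
    rw [h3] at h2
    rw [mul_div_assoc', le_div_iff₀ hB]
    linarith
  have hlt : Real.exp (-t') < Real.exp (-t) := Real.exp_lt_exp.2 (by linarith)
  refine lt_of_le_of_lt ((sampleProb_mono fun S _ => ?_).trans hconc) hlt
  rintro ⟨f, hf, hf0, hfd⟩
  by_contra hcon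
  push Not at hcon
  have hZ : supDev (scaledClass F X (s ^ 2)) X S ≤ s * A := by
    rw [hA, mul_add]; linarith
  have hmem : (fun x => s ^ 2 / max (s ^ 2) (avg X (fun x => f x ^ 2)) * f x) ∈
      scaledClass F X (s ^ 2) := ⟨f, hf, rfl⟩
  have h1 := (le_supDev (scaledClass_abs_le_one hF X hr) X S hmem).trans hZ
  rw [avg_const_mul, avg_const_mul, ← mul_sub] at h1
  set D := avg X f - avg S f with hD
  set T := avg X (fun x => f x ^ 2) with hT
  rcases le_or_gt T (s ^ 2) with hTs | hTs
  · rw [max_eq_left hTs, div_self hr.ne', one_mul] at h1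
    have h2 : A ^ 2 ≤ 2 * ((5 * √ρ / B) ^ 2 + q ^ 2) := by
      nlinarith [sq_nonneg (5 * √ρ / B - q)]
    have h3 : (5 * √ρ / B) ^ 2 = 25 * ρ / B ^ 2 := by
      rw [div_pow, mul_pow, Real.sq_sqrt hρ.le]; norm_num
    have h4 : s * A = 51 / 50 * B * A ^ 2 := by rw [hs]; ring
    have h5 := mul_le_mul_of_nonneg_left h2 (by positivity : 0 ≤ 51 / 50 * B)
    have h6 : 51 / 50 * B * (2 * ((5 * √ρ / B) ^ 2 + q ^ 2)) =
        51 * ρ / B + 17 * B * t * (X.card / (k : ℝ) ^ 2) := by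
      rw [h3, hq2, ht']; field_simp; ring
    linarith
  -- If `f` was shrunk, then `s² D ≤ s A T`, while `Ê f ≤ 0` and the Bernstein condition give `T ≤ B
  -- D`. Hence `D > 0` and `s ≤ A B`, contrary to the choice of `s`.
  · rw [max_eq_right hTs.le] at h1
    have hTpos : 0 < T := hr.trans hTs
    have h2 : T ≤ B * D := (hBern f hf).trans (mul_le_mul_of_nonneg_left (by linarith) hB.le)
    rw [div_mul_eq_mul_div, div_le_iff₀ hTpos] at h1
    have h3 : s ^ 2 * D ≤ s * A * (B * D) :=
      h1.trans (mul_le_mul_of_nonneg_left h2 (by positivity))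
    have hD0 : 0 < D := by
      by_contra h
      nlinarith
    have h4 : s ^ 2 * D = 51 / 50 * (s * A * (B * D)) := by
      rw [hs]; ring
    have h5 : 0 < s * A * (B * D) := by positivity
    linarith

/-! ### Combining the training and test samples. -/

theorem sampleProb_compl [DecidableEq 𝒳] {X : Finset 𝒳} {m u : ℕ} (h : X.card = m + u)
    (p : Finset 𝒳 → Prop) : sampleProb X m (fun S => p (X \ S)) = sampleProb X u p := by
  classical
  unfold sampleProb
  congr 2
  · refine Finset.card_nbij' (fun S => X \ S) (fun S => X \ S) ?_ ?_ ?_ ?_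
    · intro S hS
      simp only [Finset.coe_filter, Finset.mem_powersetCard, Set.mem_ofPred_eq] at hS ⊢
      refine ⟨⟨Finset.sdiff_subset, ?_⟩, hS.2⟩
      rw [Finset.card_sdiff_of_subset hS.1.1]; omega
    · intro S hS
      simp only [Finset.coe_filter, Finset.mem_powersetCard, Set.mem_ofPred_eq] at hS ⊢
      rw [Finset.sdiff_sdiff_eq_self hS.1.1]
      refine ⟨⟨Finset.sdiff_subset, ?_⟩, hS.2⟩
      rw [Finset.card_sdiff_of_subset hS.1.1]; omega
    · intro S hS
      simp only [Finset.coe_filter, Finset.mem_powersetCard, Set.mem_ofPred_eq] at hS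
      exact Finset.sdiff_sdiff_eq_self hS.1.1
    · intro S hS
      simp only [Finset.coe_filter, Finset.mem_powersetCard, Set.mem_ofPred_eq] at hS
      exact Finset.sdiff_sdiff_eq_self hS.1.1
  · rw [Finset.card_powersetCard, Finset.card_powersetCard, h, Nat.choose_symm_add]

theorem one_le_sampleProb_add {X : Finset 𝒳} {k : ℕ} (hk : k ≤ X.card)
    {p q w : Finset 𝒳 → Prop} (h : ∀ S ∈ X.powersetCard k, ¬ q S → ¬ w S → p S) :
    1 ≤ sampleProb X k p + sampleProb X k q + sampleProb X k w := by
  classical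
  have hT : (0 : ℝ) < (X.powersetCard k).card := by
    exact_mod_cast (Finset.powersetCard_nonempty.2 hk).card_pos
  unfold sampleProb
  rw [← add_div, ← add_div, one_le_div hT]
  have h1 : X.powersetCard k ⊆ (X.powersetCard k).filter p ∪ (X.powersetCard k).filter q ∪
      (X.powersetCard k).filter w := by
    intro S hS
    simp only [Finset.mem_union, Finset.mem_filter]
    have := h S hS
    tauto
  have h2 := (Finset.card_le_card h1).trans ((Finset.card_union_le _ _).trans
    (Nat.add_le_add_right (Finset.card_union_le _ _) _))
  have h3 : (((X.powersetCard k).card : ℕ) : ℝ) ≤ ((((X.powersetCard k).filter p).card +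
    ((X.powersetCard k).filter q).card + ((X.powersetCard k).filter w).card : ℕ) : ℝ) :=
    Nat.cast_le.2 h2
  push_cast at h3
  convert h3

/-- The mean over the complement of a sample `S`. -/
theorem avg_sdiff [DecidableEq 𝒳] {X S : Finset 𝒳} (hS : S ⊆ X) {m u : ℕ} (hm : S.card = m)
    (hu : (X \ S).card = u) (hm0 : 0 < m) (hu0 : 0 < u) (f : 𝒳 → ℝ) :
    avg (X \ S) f = avg X f + (m : ℝ) / u * (avg X f - avg S f) := by
  have hX : (X.card : ℝ) = m + u := by
    rw [← Finset.card_sdiff_add_card_eq_card hS, hm, hu]; push_cast; ring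
  have hm' : (0 : ℝ) < m := by exact_mod_cast hm0
  have hu' : (0 : ℝ) < u := by exact_mod_cast hu0
  unfold avg
  rw [hX, hm, hu, ← Finset.sum_sdiff hS]
  field_simp
  ring

end Transductive

theorem mainTheorem1 {𝒳 𝒴 : Type*} [DecidableEq 𝒳]
    (XN : Finset 𝒳) (N m u : ℕ) (hXN : XN.card = N) (hmu : N = m + u) (hm : 0 < m) (hu : 0 < u)
    (l : 𝒴 → 𝒴 → ℝ) (hl : ∀ y y', l y y' ∈ Set.Icc (0 : ℝ) 1)
    (φ : 𝒳 → 𝒴) (H : Set (𝒳 → 𝒴))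
    (hN : 𝒳 → 𝒴) (hN_mem : hN ∈ H) (hN_min : IsMinOn (Transductive.err l φ XN) H hN)
    (B : ℝ) (hB : 0 < B)
    (hBernstein : ∀ f ∈ Transductive.excessLossClass l φ H hN,
      Transductive.avg XN (fun x => f x ^ 2) ≤ B * Transductive.avg XN f)
    (ψm : ℝ → ℝ) (hψm : Transductive.IsSubRoot ψm)
    (hψm_bound : ∀ r, 0 ≤ r →
      B * Transductive.localComplexity (Transductive.excessLossClass l φ H hN) XN m r ≤ ψm r)
    (ψu : ℝ → ℝ) (hψu : Transductive.IsSubRoot ψu)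
    (hψu_bound : ∀ r, 0 ≤ r →
      B * Transductive.localComplexity (Transductive.excessLossClass l φ H hN) XN u r ≤ ψu r)
    (rm : ℝ) (hrm_pos : 0 < rm) (hrm : ψm rm = rm)
    (ru : ℝ) (hru_pos : 0 < ru) (hru : ψu ru = ru)
    (hhat : Finset 𝒳 → 𝒳 → 𝒴) (hhat_erm : Transductive.IsERM l φ H XN m hhat)
    (t : ℝ) (ht : 0 < t) :
    1 - 2 * Real.exp (-t) <
      Transductive.sampleProb XN m (fun S =>
        Transductive.excessRisk l φ H (XN \ S) (hhat S) ≤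
          (N : ℝ) / u * (51 * rm / B + 17 * B * t * (N / (m : ℝ) ^ 2)) +
          (N : ℝ) / m * (51 * ru / B + 17 * B * t * (N / (u : ℝ) ^ 2))) := by
  open Transductive in
  set F := excessLossClass l φ H hN with hFdef
  have hF : ∀ f ∈ F, ∀ x, |f x| ≤ 1 := by
    rintro _ ⟨h, -, rfl⟩ x
    have h1 := hl (h x) (φ x)
    have h2 := hl (hN x) (φ x)
    simp only [lossOf]
    rw [abs_le]
    constructor <;> linarith [h1.1, h1.2, h2.1, h2.2]
  have h0 : (fun _ => 0) ∈ F := ⟨hN, hN_mem, by simp⟩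
  have havg : ∀ (A : Finset 𝒳) (h : 𝒳 → 𝒴),
      avg A (fun x => lossOf l φ h x - lossOf l φ hN x) = err l φ A h - err l φ A hN :=
    fun A h => avg_sub A _ _
  set bm := 51 * rm / B + 17 * B * t * (N / (m : ℝ) ^ 2) with hbm
  set bu := 51 * ru / B + 17 * B * t * (N / (u : ℝ) ^ 2) with hbu
  have hm' : (0 : ℝ) < m := by exact_mod_cast hm
  have hu' : (0 : ℝ) < u := by exact_mod_cast hu
  have hNmu : (N : ℝ) = m + u := by rw [hmu]; push_cast; rfl
  have hbm0 : 0 ≤ bm := by positivity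
  have hbu0 : 0 ≤ bu := by positivity
  have hPm := sampleProb_exists_dev_gt_le hF h0 hm (by omega) hB hBernstein hψm hψm_bound hrm_pos
    hrm ht
  have hPu := sampleProb_exists_dev_gt_le hF h0 hu (by omega) hB hBernstein hψu hψu_bound hru_pos
    hru ht
  rw [hXN, ← hbm] at hPm
  -- The complement of a uniform `m`-subset is a uniform `u`-subset, so the second event is also one
  -- about the training set.
  rw [hXN, ← hbu, ← sampleProb_compl (hXN.trans hmu)] at hPu
  suffices hgood : ∀ S ∈ XN.powersetCard m,
      (¬ ∃ f ∈ F, avg S f ≤ 0 ∧ bm < avg XN f - avg S f) →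
      (¬ ∃ f ∈ F, avg (XN \ S) f ≤ 0 ∧ bu < avg XN f - avg (XN \ S) f) →
      excessRisk l φ H (XN \ S) (hhat S) ≤ (N : ℝ) / u * bm + (N : ℝ) / m * bu by
    have := one_le_sampleProb_add (by omega) hgood
    linarith
  intro S hS hSm hSu
  push Not at hSm hSu
  obtain ⟨hSX, hSc⟩ := Finset.mem_powersetCard.1 hS
  have hUc : (XN \ S).card = u := by
    rw [Finset.card_sdiff_of_subset hSX]; omega
  obtain ⟨hmem, hmin⟩ := hhat_erm S hS
  have hnn : ∀ h ∈ H, 0 ≤ err l φ XN h - err l φ XN hN := fun h hh => sub_nonneg.2 (hN_min hh)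
  have hhat_le : err l φ (XN \ S) (hhat S) - err l φ (XN \ S) hN ≤ (N : ℝ) / u * bm := by
    have h1 := hSm _ ⟨hhat S, hmem, rfl⟩ (by
      rw [havg]; exact sub_nonpos.2 (hmin hN_mem))
    have h2 := avg_sdiff hSX hSc hUc hm hu (fun x => lossOf l φ (hhat S) x - lossOf l φ hN x)
    have h3 : err l φ S (hhat S) - err l φ S hN ≤ 0 := sub_nonpos.2 (hmin hN_mem)
    rw [havg, havg] at h1
    rw [havg, havg, havg] at h2
    rw [h2]
    -- The test mean is `E f + (m/u) (E f - Ê f)`, and `E f ≤ E f - Ê f` because `Ê f ≤ 0`; so the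
    -- deviation is multiplied by `1 + m/u`.
    have h4 : (N : ℝ) / u = 1 + m / u := by rw [hNmu]; field_simp; ring
    rw [h4, add_mul, one_mul]
    exact add_le_add (by linarith) (mul_le_mul_of_nonneg_left h1 (by positivity))
  -- Proved for every `g`, since the infimum of the test error need not be attained. As `E f ≥ 0`
  -- for excess losses, `bu` alone would suffice; `N/m ≥ 1` only weakens it.
  have hg_le : ∀ g ∈ H, err l φ (XN \ S) hN - err l φ (XN \ S) g ≤ (N : ℝ) / m * bu := by
    intro g hg
    have h5 : (1 : ℝ) ≤ N / m := by rw [hNmu, one_le_div hm']; linarith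
    have h6 : bu ≤ N / m * bu := le_mul_of_one_le_left hbu0 h5
    rcases le_or_gt (err l φ (XN \ S) g - err l φ (XN \ S) hN) 0 with h | h
    · have h1 := hSu _ ⟨g, hg, rfl⟩ (by rw [havg]; exact h)
      rw [havg, havg] at h1
      linarith [hnn g hg]
    · linarith
  unfold excessRisk
  have : Nonempty H := ⟨⟨hN, hN_mem⟩⟩
  rw [sub_le_comm]
  refine le_ciInf fun g => ?_
  linarith [hg_le g g.2]
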